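/- **Theorem 1.** Let $K\ge 1$ and let $N_0,N_1,\dots,N_K$ be positive integers with $N_0=\min_{0\le k\le K}N_k$. Let $Q_1,\dots,Q_K$ be independent random matrices, where $Q_k$ has size $N_k\times N_{k-1}$ and its entries are i.i.d. circularly symmetric complex Gaussian variables with mean zero and unit variance, i.e. with density $\pi^{-1}e^{-|z|^2}$ on $\mathbb{C}$. Put $H=Q_KQ_{K-1}\cdots Q_1$, a matrix of size $N_K\times N_0$. Then $\det(H^\dagger H)>0$ almost surely, $\ln\det(H^\dagger H)$ is integrable, and $$\mathbb{E}\left[\ln\det(H^\dagger H)\right]=\sum_{k=1}^{K}\sum_{\ell=1}^{N_0}\psi(N_k-\ell+1)=-KN_0\gamma+\sum_{k=1}^{K}\sum_{\ell=1}^{N_0}\sum_{r=1}^{N_k-\ell}\frac1r,$$ where $\dagger$ denotes the conjugate transpose, $\psi=\Gamma'/\Gamma$ is the digamma function and $\gamma$ is the Euler–Mascheroni constant. -/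

import Mathlib

open MeasureTheory ProbabilityTheory

open scoped Matrix

/-- The standard circularly symmetric complex Gaussian law (mean zero, unit variance): the measure
on `ℂ` with density `π⁻¹ exp (-|z|²)` with respect to Lebesgue measure. -/
noncomputable def stdComplexGaussian : Measure ℂ :=
  volume.withDensity fun z => ENNReal.ofReal (Real.exp (-‖z‖ ^ 2) / Real.pi)

/-- The partial products `Q_k ⋯ Q_1` (the identity for `k = 0`) of a chain of matrices `Q_1, …, Q_K`
of sizes `N_k × N_{k-1}`. The matrix `Q_{k+1}` is `Q k` for `k : Fin K`. -/
noncomputable def chainProd {K : ℕ} {N : Fin (K + 1) → ℕ}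
    (Q : ∀ k : Fin K, Matrix (Fin (N k.succ)) (Fin (N k.castSucc)) ℂ) (i : Fin (K + 1)) :
    Matrix (Fin (N i)) (Fin (N 0)) ℂ :=
  Fin.induction (motive := fun i => Matrix (Fin (N i)) (Fin (N 0)) ℂ) 1
    (fun k P => Q k * P) i

/-- The product `H = Q_K ⋯ Q_1`, of size `N_K × N_0`. -/
noncomputable def productMatrix {K : ℕ} {N : Fin (K + 1) → ℕ}
    (Q : ∀ k : Fin K, Matrix (Fin (N k.succ)) (Fin (N k.castSucc)) ℂ) :
    Matrix (Fin (N (Fin.last K))) (Fin (N 0)) ℂ :=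
  chainProd Q (Fin.last K)

/-! The Gaussian law is invariant under `X ↦ A X B` whenever `A Aᴴ = 1` and `Bᴴ B = 1`. Writing
a factor `P` with `det (Pᴴ P) > 0` as an isometry times a square matrix, one sees that the ratio
`det ((Q P)ᴴ (Q P)) / det (Pᴴ P)` has the law of `det (Gᴴ G)` for a Gaussian matrix `G` with as many
rows as `Q` and as many columns as `P`, whatever the value of `P`. The mean of `ln det (Hᴴ H)` is
therefore the sum of the corresponding means of the Gaussian factors.

For a single Gaussian matrix with `N` rows, the Schur complement turns adding a column into
multiplying `det (Gᴴ G)` by the squared norm of the projection of this column on the orthogonal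
complement of the `n` previous ones, a standard Gaussian vector of `ℂ ^ (N - n)`. The squared norm
of such a vector in dimension `d` has moments `Γ(d + s) / Γ(d)`, and differentiating them at `s = 0`
gives the mean `Γ'(d) / Γ(d)` of its logarithm. -/

/-- The variable `f` is almost surely positive and `log f` is integrable with mean `c`. The three
properties are bundled because only together do they add up over products. -/
structure HasLogMean {α : Type*} [MeasurableSpace α] (f : α → ℝ) (μ : Measure α) (c : ℝ) :
    Prop where
  pos : ∀ᵐ x ∂μ, 0 < f x
  integrable : Integrable (fun x => Real.log (f x)) μ
  integral_eq : ∫ x, Real.log (f x) ∂μ = c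

namespace HasLogMean

variable {α β : Type*} [MeasurableSpace α] [MeasurableSpace β] {μ : Measure α} {ν : Measure β}
  {f g : α → ℝ} {c d : ℝ}

theorem one [IsProbabilityMeasure μ] : HasLogMean (fun _ => 1) μ 0 := ⟨by simp, by simp, by simp⟩

theorem congr (hf : HasLogMean f μ c) (h : f =ᵐ[μ] g) : HasLogMean g μ c := by
  have hlog : (fun x => Real.log (f x)) =ᵐ[μ] fun x => Real.log (g x) := h.fun_comp Real.log
  refine ⟨?_, hf.integrable.congr hlog, (integral_congr_ae hlog).symm.trans hf.integral_eq⟩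
  filter_upwards [hf.pos, h] with x hx hfg using hfg ▸ hx

theorem mul (hf : HasLogMean f μ c) (hg : HasLogMean g μ d) :
    HasLogMean (fun x => f x * g x) μ (c + d) := by
  have hlog : (fun x => Real.log (f x) + Real.log (g x)) =ᵐ[μ] fun x => Real.log (f x * g x) := by
    filter_upwards [hf.pos, hg.pos] with x hfx hgx using (Real.log_mul hfx.ne' hgx.ne').symm
  refine ⟨?_, (hf.integrable.add hg.integrable).congr hlog, ?_⟩
  · filter_upwards [hf.pos, hg.pos] with x hfx hgx using mul_pos hfx hgx
  · rw [← integral_congr_ae hlog, integral_add hf.integrable hg.integrable, hf.integral_eq,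
      hg.integral_eq]

theorem comp_iff_of_hasLaw {X : β → α} (hX : HasLaw X μ ν) (hf : Measurable f) :
    HasLogMean (fun b => f (X b)) ν c ↔ HasLogMean f μ c := by
  have hlog : AEStronglyMeasurable (fun x => Real.log (f x)) (ν.map X) :=
    hf.log.aestronglyMeasurable
  rw [← hX.map_eq]
  constructor
  · rintro ⟨hpos, hint, hc⟩
    exact ⟨(ae_map_iff hX.aemeasurable (measurableSet_lt measurable_const hf)).2 hpos,
      (integrable_map_measure hlog hX.aemeasurable).2 hint,
      (integral_map hX.aemeasurable hlog).trans hc⟩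
  · rintro ⟨hpos, hint, hc⟩
    exact ⟨(ae_map_iff hX.aemeasurable (measurableSet_lt measurable_const hf)).1 hpos,
      (integrable_map_measure hlog hX.aemeasurable).1 hint,
      (integral_map hX.aemeasurable hlog).symm.trans hc⟩

theorem prod_of_hasLaw_div {γ : Type*} [MeasurableSpace γ] {κ : Measure γ} {g : γ → ℝ}
    [IsProbabilityMeasure μ] [IsProbabilityMeasure ν]
    (hf : HasLogMean f μ c) (hfm : Measurable f) {F : α × β → ℝ} (hF : Measurable F)
    (hg : HasLogMean g κ d) (hgm : Measurable g)
    (hlaw : ∀ a, 0 < f a → HasLaw (fun b => F (a, b) / f a) (κ.map g) ν) :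
    HasLogMean F (μ.prod ν) (c + d) := by
  have hRm : Measurable fun p : α × β => F p / f p.1 := hF.div (hfm.comp measurable_fst)
  have hR : HasLaw (fun p : α × β => F p / f p.1) (κ.map g) (μ.prod ν) := by
    refine ⟨hRm.aemeasurable, Measure.ext fun s hs => ?_⟩
    have hsection : ∀ᵐ a ∂μ, ν (Prod.mk a ⁻¹' ((fun p : α × β => F p / f p.1) ⁻¹' s)) =
        κ.map g s := by
      filter_upwards [hf.pos] with a ha
      rw [← (hlaw a ha).map_eq]
      exact (Measure.map_apply (hRm.comp measurable_prodMk_left) hs).symm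
    rw [Measure.map_apply hRm hs, Measure.prod_apply (hRm hs), lintegral_congr_ae hsection]
    simp
  have hfst : HasLogMean (fun p : α × β => f p.1) (μ.prod ν) c :=
    (comp_iff_of_hasLaw measurePreserving_fst.hasLaw hfm).2 hf
  have hratio : HasLogMean id (κ.map g) d :=
    (comp_iff_of_hasLaw ⟨hgm.aemeasurable, rfl⟩ measurable_id).1 hg
  refine (hfst.mul ((comp_iff_of_hasLaw hR measurable_id).2 hratio)).congr ?_
  filter_upwards [hfst.pos] with p hp using mul_div_cancel₀ _ hp.ne'

theorem of_rpow_moments [IsProbabilityMeasure μ] (hpos : ∀ᵐ x ∂μ, 0 < f x)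
    {M : ℝ → ℝ} (hM : HasDerivAt M c 0)
    (hint : ∀ᶠ s in nhds (0 : ℝ), Integrable (fun x => f x ^ s) μ)
    (hmom : ∀ᶠ s in nhds (0 : ℝ), ∫ x, f x ^ s ∂μ = M s) :
    HasLogMean f μ c := by
  have hrpow : ∀ s : ℝ, (fun x => f x ^ s) =ᵐ[μ] fun x => Real.exp (s * Real.log (f x)) := by
    intro s
    filter_upwards [hpos] with x hx
    rw [Real.rpow_def_of_pos hx, mul_comm]
  have hmem : (0 : ℝ) ∈ interior (integrableExpSet (fun x => Real.log (f x)) μ) := by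
    rw [mem_interior_iff_mem_nhds]
    filter_upwards [hint] with s hs using hs.congr (hrpow s)
  have hmgf : mgf (fun x => Real.log (f x)) μ =ᶠ[nhds 0] M := by
    filter_upwards [hmom] with s hs
    rw [← hs, mgf, integral_congr_ae (hrpow s)]
  exact ⟨hpos, integrable_of_mem_interior_integrableExpSet hmem,
    (deriv_mgf_zero hmem).symm.trans (hmgf.deriv_eq.trans hM.deriv)⟩

end HasLogMean

section IsotropicGaussian

variable (E : Type*) [NormedAddCommGroup E] [InnerProductSpace ℝ E] [FiniteDimensional ℝ E]
  [MeasurableSpace E] [BorelSpace E]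

/-- The centred Gaussian measure on a Euclidean space with density proportional to
`exp (-‖x‖ ^ 2)`. On a complex Euclidean space, seen as a real one, it is the law of a vector of
independent standard complex Gaussian coordinates. -/
noncomputable def isotropicGaussian : Measure E :=
  volume.withDensity fun x =>
    ENNReal.ofReal (Real.exp (-‖x‖ ^ 2) / Real.pi ^ ((Module.finrank ℝ E : ℝ) / 2))

variable {E}

theorem integral_isotropicGaussian {F : Type*} [NormedAddCommGroup F] [NormedSpace ℝ F]
    (f : E → F) :
    ∫ x, f x ∂(isotropicGaussian E) =
      ∫ x, (Real.exp (-‖x‖ ^ 2) / Real.pi ^ ((Module.finrank ℝ E : ℝ) / 2)) • f x := by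
  rw [isotropicGaussian, integral_withDensity_eq_integral_toReal_smul (by fun_prop) (by simp)]
  simp_rw [fun x : E => ENNReal.toReal_ofReal (show 0 ≤ Real.exp (-‖x‖ ^ 2) /
    Real.pi ^ ((Module.finrank ℝ E : ℝ) / 2) by positivity)]

instance isProbabilityMeasure_isotropicGaussian : IsProbabilityMeasure (isotropicGaussian E) := by
  have hpos : 0 < Real.pi ^ ((Module.finrank ℝ E : ℝ) / 2) := by positivity
  have hgauss : ∫ x : E, Real.exp (-‖x‖ ^ 2) = Real.pi ^ ((Module.finrank ℝ E : ℝ) / 2) := by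
    simpa using GaussianFourier.integral_rexp_neg_mul_sq_norm (V := E) one_pos
  have hint : Integrable fun x : E => Real.exp (-‖x‖ ^ 2) :=
    .of_integral_ne_zero (hgauss ▸ hpos.ne')
  refine ⟨?_⟩
  rw [isotropicGaussian, withDensity_apply _ MeasurableSet.univ, Measure.restrict_univ,
    ← ofReal_integral_eq_lintegral_ofReal (hint.div_const _)
      (Filter.Eventually.of_forall fun x => by positivity),
    integral_div, hgauss, div_self hpos.ne', ENNReal.ofReal_one]

theorem charFun_isotropicGaussian (t : E) :
    charFun (isotropicGaussian E) t = Complex.exp (-‖t‖ ^ 2 / 4) := by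
  have hfourier := GaussianFourier.integral_cexp_neg_mul_sq_norm_add (V := E) (b := 1) (by simp)
    Complex.I t
  have hpi : ((Real.pi ^ ((Module.finrank ℝ E : ℝ) / 2) : ℝ) : ℂ) ≠ 0 := by
    exact_mod_cast (by positivity : 0 < Real.pi ^ ((Module.finrank ℝ E : ℝ) / 2)).ne'
  have hdensity : ∀ x : E,
      (Real.exp (-‖x‖ ^ 2) / Real.pi ^ ((Module.finrank ℝ E : ℝ) / 2)) •
        Complex.exp ((inner ℝ x t : ℝ) * Complex.I) =
      Complex.exp (-1 * (‖x‖ : ℂ) ^ 2 + Complex.I * (inner ℝ t x : ℝ)) /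
        ((Real.pi ^ ((Module.finrank ℝ E : ℝ) / 2) : ℝ) : ℂ) := by
    intro x
    rw [Complex.exp_add, Complex.real_smul, real_inner_comm, mul_comm Complex.I]
    push_cast
    ring_nf
  rw [charFun_apply, integral_isotropicGaussian]
  simp_rw [hdensity]
  rw [integral_div, hfourier]
  rw [Complex.ofReal_cpow Real.pi_pos.le] at hpi ⊢
  push_cast at hpi ⊢
  rw [div_one, mul_div_cancel_left₀ _ hpi]
  simp

theorem integral_exp_neg_sq_norm_mul_rpow [Nontrivial E] {s : ℝ}
    (hs : 0 < (Module.finrank ℝ E : ℝ) / 2 + s) :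
    ∫ x : E, Real.exp (-‖x‖ ^ 2) * (‖x‖ ^ 2) ^ s =
      (Module.finrank ℝ E / 2) * volume.real (Metric.ball (0 : E) 1) *
        Real.Gamma (Module.finrank ℝ E / 2 + s) := by
  have hdim : 1 ≤ Module.finrank ℝ E := Module.finrank_pos
  have hradial : ∀ r ∈ Set.Ioi (0 : ℝ),
      r ^ (Module.finrank ℝ E - 1) • (Real.exp (-r ^ 2) * (r ^ 2) ^ s) =
        r ^ ((Module.finrank ℝ E : ℝ) - 1 + 2 * s) * Real.exp (-r ^ (2 : ℝ)) := by
    intro r (hr : 0 < r)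
    rw [Real.rpow_add hr, ← Nat.cast_pred hdim, Real.rpow_natCast, Real.rpow_mul hr.le,
      Real.rpow_two, smul_eq_mul]
    ring
  rw [integral_fun_norm_addHaar volume fun r : ℝ => Real.exp (-r ^ 2) * (r ^ 2) ^ s,
    setIntegral_congr_fun measurableSet_Ioi hradial,
    integral_rpow_mul_exp_neg_rpow two_pos (by linarith), nsmul_eq_mul, smul_eq_mul]
  ring_nf

theorem integral_norm_sq_rpow_isotropicGaussian [Nontrivial E] {s : ℝ}
    (hs : 0 < (Module.finrank ℝ E : ℝ) / 2 + s) :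
    ∫ x, (‖x‖ ^ 2) ^ s ∂(isotropicGaussian E) =
      Real.Gamma (Module.finrank ℝ E / 2 + s) / Real.Gamma (Module.finrank ℝ E / 2) := by
  have hdim : (0 : ℝ) < Module.finrank ℝ E / 2 :=
    half_pos (Nat.cast_pos.2 Module.finrank_pos)
  set C : ℝ := (Module.finrank ℝ E / 2) * volume.real (Metric.ball (0 : E) 1) /
    Real.pi ^ ((Module.finrank ℝ E : ℝ) / 2) with hC
  have hmoment : ∀ u : ℝ, 0 < (Module.finrank ℝ E : ℝ) / 2 + u →
      ∫ x, (‖x‖ ^ 2) ^ u ∂(isotropicGaussian E) = C * Real.Gamma (Module.finrank ℝ E / 2 + u) := by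
    intro u hu
    simp_rw [integral_isotropicGaussian, smul_eq_mul, div_mul_eq_mul_div]
    rw [integral_div, integral_exp_neg_sq_norm_mul_rpow hu, hC]
    ring
  have hnormalized : C * Real.Gamma (Module.finrank ℝ E / 2) = 1 := by
    simpa using (hmoment 0 (by simpa using hdim)).symm
  rw [hmoment s hs, eq_div_iff (Real.Gamma_pos_of_pos hdim).ne', mul_right_comm, hnormalized,
    one_mul]

theorem hasLogMean_norm_sq_isotropicGaussian [Nontrivial E] :
    HasLogMean (fun x => ‖x‖ ^ 2) (isotropicGaussian E)
      (logDeriv Real.Gamma (Module.finrank ℝ E / 2)) := by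
  have hdim : (0 : ℝ) < Module.finrank ℝ E / 2 :=
    half_pos (Nat.cast_pos.2 Module.finrank_pos)
  have hnear : ∀ᶠ s in nhds (0 : ℝ), 0 < (Module.finrank ℝ E : ℝ) / 2 + s :=
    (continuous_const.add continuous_id).continuousAt.eventually_mem
      (Ioi_mem_nhds (by simpa using hdim))
  refine HasLogMean.of_rpow_moments
    (M := fun s => Real.Gamma (Module.finrank ℝ E / 2 + s) / Real.Gamma (Module.finrank ℝ E / 2))
    ?_ ?_ ?_ ?_
  · have hne : ∀ᵐ x ∂(isotropicGaussian E), x ≠ 0 :=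
      (withDensity_absolutelyContinuous _ _).ae_le (Measure.ae_ne volume 0)
    filter_upwards [hne] with x hx using by positivity
  · have hΓ : DifferentiableAt ℝ Real.Gamma (Module.finrank ℝ E / 2 + 0) :=
      Real.differentiableAt_Gamma fun k => by
        have : (0 : ℝ) ≤ k := k.cast_nonneg
        linarith
    simpa [logDeriv_apply] using (hΓ.hasDerivAt.comp_const_add _ 0).div_const _
  · filter_upwards [hnear] with s hs
    refine .of_integral_ne_zero ?_
    rw [integral_norm_sq_rpow_isotropicGaussian hs]
    exact (div_pos (Real.Gamma_pos_of_pos hs) (Real.Gamma_pos_of_pos hdim)).ne'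
  · filter_upwards [hnear] with s hs using integral_norm_sq_rpow_isotropicGaussian hs

end IsotropicGaussian

theorem stdComplexGaussian_eq_isotropicGaussian : stdComplexGaussian = isotropicGaussian ℂ := by
  simp [stdComplexGaussian, isotropicGaussian, Complex.finrank_real_complex]

instance isProbabilityMeasure_stdComplexGaussian : IsProbabilityMeasure stdComplexGaussian :=
  stdComplexGaussian_eq_isotropicGaussian ▸ inferInstance

theorem map_toLp_pi_stdComplexGaussian (ι : Type*) [Fintype ι] :
    (Measure.pi fun _ : ι => stdComplexGaussian).map (WithLp.toLp 2) =
      isotropicGaussian (EuclideanSpace ℂ ι) := by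
  simp_rw [stdComplexGaussian_eq_isotropicGaussian]
  have : IsProbabilityMeasure
      ((Measure.pi fun _ : ι => isotropicGaussian ℂ).map (WithLp.toLp 2)) :=
    Measure.isProbabilityMeasure_map (WithLp.measurable_toLp 2 _).aemeasurable
  refine Measure.ext_of_charFun (E := EuclideanSpace ℂ ι) (funext fun t => ?_)
  simp_rw [charFun_pi, charFun_isotropicGaussian, ← Complex.exp_sum, ← Complex.ofReal_pow,
    EuclideanSpace.norm_sq_eq]
  simp [Finset.sum_div, neg_div]

section Ginibre

variable {m n p q : Type*}

noncomputable instance matrixMeasurableSpace : MeasurableSpace (Matrix m n ℂ) :=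
  inferInstanceAs (MeasurableSpace (m → n → ℂ))

instance matrixBorelSpace [Countable m] [Countable n] : BorelSpace (Matrix m n ℂ) :=
  inferInstanceAs (BorelSpace (m → n → ℂ))

instance matrixSecondCountableTopology [Countable m] [Countable n] :
    SecondCountableTopology (Matrix m n ℂ) :=
  inferInstanceAs (SecondCountableTopology (m → n → ℂ))

theorem measurable_fromCols :
    Measurable fun X : Matrix m n ℂ × Matrix m p ℂ => Matrix.fromCols X.1 X.2 := by
  refine measurable_pi_lambda _ fun i => measurable_pi_lambda _ fun j => ?_
  rcases j with j | j
  · exact (measurable_pi_apply j).comp ((measurable_pi_apply i).comp measurable_fst)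
  · exact (measurable_pi_apply j).comp ((measurable_pi_apply i).comp measurable_snd)

variable [Fintype m] [Fintype n] [Fintype p] [Fintype q]

/-- Complex matrices as vectors of a Euclidean space, so that the norm becomes the Frobenius one. -/
noncomputable def matrixEuclideanEquiv (m n : Type*) [Fintype m] [Fintype n] :
    Matrix m n ℂ ≃ᵐ EuclideanSpace ℂ (m × n) :=
  (MeasurableEquiv.curry m n ℂ).symm.trans (MeasurableEquiv.toLp 2 (m × n → ℂ))

theorem inner_matrixEuclideanEquiv (X T : Matrix m n ℂ) :
    inner ℝ (matrixEuclideanEquiv m n X) (matrixEuclideanEquiv m n T) = (Tᴴ * X).trace.re := by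
  have happly : ∀ (Y : Matrix m n ℂ) (e : m × n), matrixEuclideanEquiv m n Y e = Y e.1 e.2 :=
    fun _ _ => rfl
  simp_rw [PiLp.inner_apply, happly]
  rw [Fintype.sum_prod_type, Finset.sum_comm]
  simp [Matrix.trace, Matrix.mul_apply, Complex.inner]

/-- The law of a complex Ginibre matrix, a matrix with independent standard complex Gaussian
entries, defined through its density on the Euclidean space of matrices so that its characteristic
function is at hand. -/
noncomputable def ginibre (m n : Type*) [Fintype m] [Fintype n] : Measure (Matrix m n ℂ) :=
  (isotropicGaussian (EuclideanSpace ℂ (m × n))).map (matrixEuclideanEquiv m n).symm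

theorem ginibre_eq_map_pi_stdComplexGaussian :
    ginibre m n = (Measure.pi fun _ : m × n => stdComplexGaussian).map
      (MeasurableEquiv.curry m n ℂ) := by
  rw [ginibre, ← map_toLp_pi_stdComplexGaussian,
    Measure.map_map (matrixEuclideanEquiv m n).symm.measurable (WithLp.measurable_toLp 2 _)]
  rfl

instance isProbabilityMeasure_ginibre : IsProbabilityMeasure (ginibre m n) :=
  Measure.isProbabilityMeasure_map (matrixEuclideanEquiv m n).symm.measurable.aemeasurable

/-- The characteristic function of a measure on complex matrices for the real Frobenius inner
product `Re tr (Tᴴ X)`. -/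
noncomputable def frobeniusCharFun (μ : Measure (Matrix m n ℂ)) (T : Matrix m n ℂ) : ℂ :=
  ∫ X, Complex.exp ((Tᴴ * X).trace.re * Complex.I) ∂μ

theorem charFun_map_matrixEuclideanEquiv (μ : Measure (Matrix m n ℂ)) (T : Matrix m n ℂ) :
    charFun (μ.map (matrixEuclideanEquiv m n)) (matrixEuclideanEquiv m n T) =
      frobeniusCharFun μ T := by
  rw [charFun_apply, integral_map_equiv, frobeniusCharFun]
  simp_rw [inner_matrixEuclideanEquiv]

theorem frobeniusCharFun_ginibre (T : Matrix m n ℂ) :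
    frobeniusCharFun (ginibre m n) T = Complex.exp (-(Tᴴ * T).trace.re / 4) := by
  rw [← charFun_map_matrixEuclideanEquiv, ginibre, MeasurableEquiv.map_map_symm,
    charFun_isotropicGaussian, ← inner_matrixEuclideanEquiv, real_inner_self_eq_norm_sq,
    Complex.ofReal_pow]

theorem eq_ginibre_of_frobeniusCharFun {μ : Measure (Matrix m n ℂ)} [IsFiniteMeasure μ]
    (h : ∀ T, frobeniusCharFun μ T = Complex.exp (-(Tᴴ * T).trace.re / 4)) :
    μ = ginibre m n := by
  refine (matrixEuclideanEquiv m n).map_measurableEquiv_injective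
    (Measure.ext_of_charFun (funext fun t => ?_))
  obtain ⟨T, rfl⟩ := (matrixEuclideanEquiv m n).surjective t
  rw [charFun_map_matrixEuclideanEquiv, charFun_map_matrixEuclideanEquiv, h,
    frobeniusCharFun_ginibre]

theorem hasLaw_mul_mul_ginibre [DecidableEq m] [DecidableEq n] (A : Matrix m p ℂ) (B : Matrix q n ℂ)
    (hA : A * Aᴴ = 1) (hB : Bᴴ * B = 1) :
    HasLaw (fun X => A * X * B) (ginibre m n) (ginibre p q) := by
  have hmeas : Measurable fun X : Matrix p q ℂ => A * X * B := Continuous.measurable (by fun_prop)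
  have := Measure.isProbabilityMeasure_map (μ := ginibre p q) hmeas.aemeasurable
  refine ⟨hmeas.aemeasurable, eq_ginibre_of_frobeniusCharFun fun T => ?_⟩
  have hadjoint : ∀ X : Matrix p q ℂ,
      (Tᴴ * (A * X * B)).trace = ((Aᴴ * T * Bᴴ)ᴴ * X).trace := fun X => by
    rw [← Matrix.mul_assoc, Matrix.trace_mul_comm]
    simp only [Matrix.conjTranspose_mul, Matrix.conjTranspose_conjTranspose, Matrix.mul_assoc]
  have hisometry : ((Aᴴ * T * Bᴴ)ᴴ * (Aᴴ * T * Bᴴ)).trace = (Tᴴ * T).trace := by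
    rw [← hadjoint]
    simp only [← Matrix.mul_assoc]
    rw [Matrix.mul_assoc Tᴴ, hA, Matrix.mul_one, Matrix.mul_assoc _ _ B, hB, Matrix.mul_one]
  rw [frobeniusCharFun, integral_map hmeas.aemeasurable (by fun_prop)]
  simp_rw [hadjoint]
  rw [← frobeniusCharFun, frobeniusCharFun_ginibre, hisometry]

theorem hasLaw_fromCols_ginibre :
    HasLaw (fun X => Matrix.fromCols X.1 X.2) (ginibre m (n ⊕ p))
      ((ginibre m n).prod (ginibre m p)) := by
  have := Measure.isProbabilityMeasure_map (μ := (ginibre m n).prod (ginibre m p))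
    measurable_fromCols.aemeasurable
  refine ⟨measurable_fromCols.aemeasurable, eq_ginibre_of_frobeniusCharFun fun T => ?_⟩
  obtain ⟨S, U, rfl⟩ : ∃ S U, T = Matrix.fromCols S U := ⟨_, _, (Matrix.fromCols_toCols T).symm⟩
  have hinner : ∀ (X : Matrix m n ℂ) (Y : Matrix m p ℂ),
      ((Matrix.fromCols S U)ᴴ * Matrix.fromCols X Y).trace =
        (Sᴴ * X).trace + (Uᴴ * Y).trace := fun X Y => by
    rw [Matrix.conjTranspose_fromCols_eq_fromRows_conjTranspose, Matrix.fromRows_mul_fromCols]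
    simp [Matrix.trace]
  rw [frobeniusCharFun, integral_map measurable_fromCols.aemeasurable (by fun_prop)]
  simp_rw [hinner, Complex.add_re, Complex.ofReal_add, add_mul, Complex.exp_add]
  rw [integral_prod_mul (fun X : Matrix m n ℂ => Complex.exp ((Sᴴ * X).trace.re * Complex.I))
      fun Y : Matrix m p ℂ => Complex.exp ((Uᴴ * Y).trace.re * Complex.I),
    ← frobeniusCharFun, ← frobeniusCharFun, frobeniusCharFun_ginibre, frobeniusCharFun_ginibre,
    ← Complex.exp_add]
  ring_nf

theorem hasLaw_submatrix_ginibre (e : p ≃ n) :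
    HasLaw (fun X => X.submatrix id e) (ginibre m p) (ginibre m n) := by
  classical
  have hperm : ((1 : Matrix n n ℂ).submatrix id e)ᴴ * (1 : Matrix n n ℂ).submatrix id e = 1 := by
    rw [Matrix.conjTranspose_submatrix, ← Matrix.submatrix_mul _ _ _ _ _ Function.bijective_id]
    simp
  have hmul : ∀ X : Matrix m n ℂ,
      (1 : Matrix m m ℂ) * X * (1 : Matrix n n ℂ).submatrix id e = X.submatrix id e := fun X => by
    simpa using Matrix.mul_submatrix_one (Equiv.refl n) e X
  simpa only [hmul] using hasLaw_mul_mul_ginibre (1 : Matrix m m ℂ) _ (by simp) hperm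

end Ginibre

section GramDet

variable {m n p k : Type*} [Fintype m] [Fintype n] [Fintype p] [Fintype k]

theorem exists_isometry_conjTranspose_mul_eq_zero [DecidableEq k]
    (hcard : Fintype.card n + Fintype.card k ≤ Fintype.card m) (W : Matrix m n ℂ) :
    ∃ V : Matrix m k ℂ, Vᴴ * V = 1 ∧ Vᴴ * W = 0 := by
  let S : Submodule ℂ (EuclideanSpace ℂ m) :=
    Submodule.span ℂ (Set.range fun j => WithLp.toLp 2 (W.col j))
  have hrank : Fintype.card k ≤ Module.finrank ℂ Sᗮ := by
    have hS : Module.finrank ℂ S ≤ Fintype.card n := finrank_range_le_card _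
    have hsum := S.finrank_add_finrank_orthogonal
    rw [finrank_euclideanSpace] at hsum
    omega
  let v : k → Sᗮ := fun i => stdOrthonormalBasis ℂ Sᗮ (Fin.castLE hrank (Fintype.equivFin k i))
  have hv : Orthonormal ℂ v := (stdOrthonormalBasis ℂ Sᗮ).orthonormal.comp _
    ((Fin.castLE_injective hrank).comp (Fintype.equivFin k).injective)
  have hinner : ∀ (x y : EuclideanSpace ℂ m), ∑ l, star (x l) * y l = inner ℂ x y := fun x y => by
    simp [PiLp.inner_apply, mul_comm]
  refine ⟨Matrix.of fun i j => (v j : EuclideanSpace ℂ m) i, ?_, ?_⟩ <;> ext i j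
  · simpa [Matrix.mul_apply, Matrix.one_apply] using
      (hinner (v i) (v j)).trans (orthonormal_iff_ite.1 hv i j)
  · have hcol : WithLp.toLp 2 (W.col j) ∈ S := Submodule.subset_span ⟨j, rfl⟩
    exact (hinner (v i) (WithLp.toLp 2 (W.col j))).trans
      (Submodule.inner_left_of_mem_orthogonal hcol (v i).2)

variable [DecidableEq n] [DecidableEq p]

/-- The Gram determinant `det (Aᴴ A)` of the columns of a complex matrix, as a real number. -/
noncomputable def gramDet (A : Matrix m n ℂ) : ℝ := (Aᴴ * A).det.re

open scoped ComplexOrder in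
theorem det_conjTranspose_mul_self_eq_gramDet (A : Matrix m n ℂ) :
    (Aᴴ * A).det = (gramDet A : ℂ) := by
  have hnonneg := (Matrix.posSemidef_conjTranspose_mul_self A).det_nonneg
  exact Complex.ext rfl (Complex.nonneg_iff.1 hnonneg).2.symm

theorem isUnit_det_of_gramDet_pos {A : Matrix m n ℂ} (hA : 0 < gramDet A) :
    IsUnit (Aᴴ * A).det := by
  rw [det_conjTranspose_mul_self_eq_gramDet, isUnit_iff_ne_zero]
  exact_mod_cast hA.ne'

theorem continuous_gramDet : Continuous (gramDet : Matrix m n ℂ → ℝ) :=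
  Complex.continuous_re.comp (Continuous.matrix_det (by fun_prop))

theorem gramDet_one : gramDet (1 : Matrix n n ℂ) = 1 := by simp [gramDet]

theorem gramDet_submatrix_equiv (A : Matrix m n ℂ) (e : p ≃ n) :
    gramDet (A.submatrix id e) = gramDet A := by
  rw [gramDet, gramDet, Matrix.conjTranspose_submatrix,
    ← Matrix.submatrix_mul _ _ _ id _ Function.bijective_id, Matrix.det_submatrix_equiv_self]

theorem gramDet_mul_square (A : Matrix m n ℂ) (R : Matrix n n ℂ) :
    gramDet (A * R) = gramDet A * ‖R.det‖ ^ 2 := by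
  rw [← Complex.ofReal_inj, ← det_conjTranspose_mul_self_eq_gramDet, Matrix.conjTranspose_mul,
    Matrix.mul_assoc, ← Matrix.mul_assoc Aᴴ, Matrix.det_mul, Matrix.det_mul,
    Matrix.det_conjTranspose, det_conjTranspose_mul_self_eq_gramDet]
  push_cast
  rw [← Complex.conj_mul', starRingEnd_apply]
  ring

open scoped ComplexOrder MatrixOrder in
theorem exists_eq_isometry_mul_of_gramDet_pos {A : Matrix m n ℂ} (hA : 0 < gramDet A) :
    ∃ (U : Matrix m n ℂ) (R : Matrix n n ℂ), Uᴴ * U = 1 ∧ A = U * R := by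
  obtain ⟨R, hR⟩ := CStarAlgebra.nonneg_iff_eq_star_mul_self.mp
    (Matrix.posSemidef_conjTranspose_mul_self A).nonneg
  rw [Matrix.star_eq_conjTranspose] at hR
  have hdet : IsUnit R.det :=
    isUnit_of_mul_isUnit_right (Matrix.det_mul Rᴴ R ▸ hR ▸ isUnit_det_of_gramDet_pos hA)
  refine ⟨A * R⁻¹, R, ?_, (Matrix.nonsing_inv_mul_cancel_right _ _ hdet).symm⟩
  calc (A * R⁻¹)ᴴ * (A * R⁻¹) = R⁻¹ᴴ * (Aᴴ * A) * R⁻¹ := by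
        simp only [Matrix.conjTranspose_mul, Matrix.mul_assoc]
    _ = (R * R⁻¹)ᴴ * (R * R⁻¹) := by
        simp only [hR, Matrix.conjTranspose_mul, Matrix.mul_assoc]
    _ = 1 := by rw [Matrix.mul_nonsing_inv _ hdet, Matrix.conjTranspose_one, Matrix.one_mul]

theorem mul_inv_mul_conjTranspose_add_mul_conjTranspose_eq_one [DecidableEq m] [DecidableEq k]
    (hcard : Fintype.card n + Fintype.card k = Fintype.card m) {W : Matrix m n ℂ}
    (hW : 0 < gramDet W) {V : Matrix m k ℂ} (hV : Vᴴ * V = 1) (hVW : Vᴴ * W = 0) :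
    W * (Wᴴ * W)⁻¹ * Wᴴ + V * Vᴴ = 1 := by
  have hWV : Wᴴ * V = 0 := by simpa using congrArg Matrix.conjTranspose hVW
  have hleft : Matrix.fromRows ((Wᴴ * W)⁻¹ * Wᴴ) Vᴴ * Matrix.fromCols W V = 1 := by
    rw [Matrix.fromRows_mul_fromCols, Matrix.mul_assoc, Matrix.mul_assoc, hWV, hV, hVW,
      Matrix.nonsing_inv_mul _ (isUnit_det_of_gramDet_pos hW), Matrix.mul_zero,
      Matrix.fromBlocks_one]
  have e : n ⊕ k ≃ m := Fintype.equivOfCardEq (by rw [Fintype.card_sum, hcard])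
  rw [Matrix.mul_assoc, ← Matrix.fromCols_mul_fromRows]
  exact (Matrix.mul_eq_one_comm_of_equiv e).1 hleft

theorem gramDet_fromCols [DecidableEq k] (hcard : Fintype.card n + Fintype.card k = Fintype.card m)
    {W : Matrix m n ℂ} (hW : 0 < gramDet W) {V : Matrix m k ℂ} (hV : Vᴴ * V = 1)
    (hVW : Vᴴ * W = 0) (X : Matrix m p ℂ) :
    gramDet (Matrix.fromCols W X) = gramDet W * gramDet (Vᴴ * X) := by
  classical
  have hunit := isUnit_det_of_gramDet_pos hW
  have := Matrix.invertibleOfIsUnitDet _ hunit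
  have hschur : Xᴴ * X - Xᴴ * W * (Wᴴ * W)⁻¹ * (Wᴴ * X) = (Vᴴ * X)ᴴ * (Vᴴ * X) := by
    have hcomplete := congrArg (fun P => Xᴴ * P * X)
      (mul_inv_mul_conjTranspose_add_mul_conjTranspose_eq_one hcard hW hV hVW)
    simp only [Matrix.mul_add, Matrix.add_mul, Matrix.mul_one] at hcomplete
    rw [← hcomplete]
    simp only [Matrix.conjTranspose_mul, Matrix.conjTranspose_conjTranspose, Matrix.mul_assoc,
      add_sub_cancel_left]
  rw [← Complex.ofReal_inj, Complex.ofReal_mul]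
  simp only [← det_conjTranspose_mul_self_eq_gramDet]
  rw [Matrix.conjTranspose_fromCols_eq_fromRows_conjTranspose, Matrix.fromRows_mul_fromCols,
    Matrix.det_fromBlocks₁₁, Matrix.invOf_eq_nonsing_inv, hschur]

end GramDet

section GinibreGramDet

variable {m n p k : Type*} [Fintype m] [Fintype n] [Fintype p] [Fintype k] [DecidableEq n]

theorem measurable_gramDet : Measurable (gramDet : Matrix m n ℂ → ℝ) :=
  continuous_gramDet.measurable

theorem hasLaw_gramDet_ginibre : HasLaw gramDet ((ginibre m n).map gramDet) (ginibre m n) :=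
  ⟨measurable_gramDet.aemeasurable, rfl⟩

theorem hasLaw_gramDet_mul_div_ginibre {A : Matrix m n ℂ} (hA : 0 < gramDet A) :
    HasLaw (fun X : Matrix p m ℂ => gramDet (X * A) / gramDet A) ((ginibre p n).map gramDet)
      (ginibre p m) := by
  classical
  obtain ⟨U, R, hU, rfl⟩ := exists_eq_isometry_mul_of_gramDet_pos hA
  have hR : gramDet (U * R) = ‖R.det‖ ^ 2 := by
    rw [gramDet_mul_square, gramDet, hU, Matrix.det_one, Complex.one_re, one_mul]
  have hratio : ∀ X : Matrix p m ℂ,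
      gramDet (X * (U * R)) / gramDet (U * R) = gramDet ((1 : Matrix p p ℂ) * X * U) := fun X => by
    rw [← Matrix.mul_assoc, gramDet_mul_square, ← hR, mul_div_cancel_right₀ _ hA.ne',
      Matrix.one_mul]
  simp_rw [hratio]
  exact hasLaw_gramDet_ginibre.comp (hasLaw_mul_mul_ginibre 1 U (by simp) hU)

theorem hasLaw_gramDet_fromCols_div_ginibre [DecidableEq p]
    (hcard : Fintype.card n + Fintype.card k = Fintype.card m) {W : Matrix m n ℂ}
    (hW : 0 < gramDet W) :
    HasLaw (fun X => gramDet (Matrix.fromCols W X) / gramDet W) ((ginibre k p).map gramDet)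
      (ginibre m p) := by
  classical
  obtain ⟨V, hV, hVW⟩ := exists_isometry_conjTranspose_mul_eq_zero (k := k) hcard.le W
  have hratio : ∀ X : Matrix m p ℂ,
      gramDet (Matrix.fromCols W X) / gramDet W = gramDet (Vᴴ * X * (1 : Matrix p p ℂ)) :=
    fun X => by
      rw [gramDet_fromCols hcard hW hV hVW, mul_div_cancel_left₀ _ hW.ne', Matrix.mul_one]
  simp_rw [hratio]
  exact hasLaw_gramDet_ginibre.comp (hasLaw_mul_mul_ginibre Vᴴ 1 (by simpa using hV) (by simp))

theorem hasLogMean_gramDet_ginibre_of_unique [Nonempty m] [Unique n] :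
    HasLogMean gramDet (ginibre m n) (logDeriv Real.Gamma (Fintype.card m)) := by
  have hlaw : HasLaw (matrixEuclideanEquiv m n).symm (ginibre m n)
      (isotropicGaussian (EuclideanSpace ℂ (m × n))) :=
    ⟨(matrixEuclideanEquiv m n).symm.measurable.aemeasurable, rfl⟩
  have hnorm : ∀ x, gramDet ((matrixEuclideanEquiv m n).symm x) = ‖x‖ ^ 2 := fun x => by
    rw [← real_inner_self_eq_norm_sq, ← (matrixEuclideanEquiv m n).apply_symm_apply x,
      inner_matrixEuclideanEquiv]
    simp [gramDet, Matrix.trace]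
  have hdim : (Module.finrank ℝ (EuclideanSpace ℂ (m × n)) : ℝ) / 2 = Fintype.card m := by
    rw [← Module.finrank_mul_finrank ℝ ℂ, finrank_euclideanSpace, Complex.finrank_real_complex]
    simp
  rw [← HasLogMean.comp_iff_of_hasLaw hlaw measurable_gramDet, ← hdim]
  simp_rw [hnorm]
  exact hasLogMean_norm_sq_isotropicGaussian

theorem hasLogMean_gramDet_ginibre {n : ℕ} (hn : n ≤ Fintype.card m) :
    HasLogMean gramDet (ginibre m (Fin n))
      (∑ l ∈ Finset.Icc 1 n, logDeriv Real.Gamma (Fintype.card m - l + 1)) := by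
  induction n with
  | zero =>
    have hempty : (gramDet : Matrix m (Fin 0) ℂ → ℝ) = fun _ => 1 := by ext A; simp [gramDet]
    simpa [hempty] using HasLogMean.one
  | succ n ih =>
    have hcard : Fintype.card (Fin n) + Fintype.card (Fin (Fintype.card m - n)) =
        Fintype.card m := by
      rw [Fintype.card_fin, Fintype.card_fin]
      omega
    have : Nonempty (Fin (Fintype.card m - n)) := ⟨⟨0, by omega⟩⟩
    have hcolumn : HasLogMean gramDet (ginibre (Fin (Fintype.card m - n)) (Fin 1))
        (logDeriv Real.Gamma (Fintype.card m - (n + 1 : ℕ) + 1)) := by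
      have hsize : (Fintype.card m : ℝ) - (n + 1 : ℕ) + 1 =
          Fintype.card (Fin (Fintype.card m - n)) := by
        rw [Fintype.card_fin, Nat.cast_sub (by omega)]
        push_cast
        ring
      exact hsize ▸ hasLogMean_gramDet_ginibre_of_unique
    rw [Finset.sum_Icc_succ_top (by omega), ← HasLogMean.comp_iff_of_hasLaw
      (hasLaw_submatrix_ginibre finSumFinEquiv.symm) measurable_gramDet]
    simp_rw [gramDet_submatrix_equiv]
    rw [← HasLogMean.comp_iff_of_hasLaw hasLaw_fromCols_ginibre measurable_gramDet]
    exact (ih (by omega)).prod_of_hasLaw_div measurable_gramDet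
      (measurable_gramDet.comp measurable_fromCols) hcolumn measurable_gramDet
      fun W => hasLaw_gramDet_fromCols_div_ginibre hcard

end GinibreGramDet

section IndependentGinibre

theorem pi_sigma_map_piCurry {ι : Type*} [Fintype ι] {κ : ι → Type*} [∀ i, Fintype (κ i)]
    {X : ∀ i, κ i → Type*} [∀ i j, MeasurableSpace (X i j)] (μ : ∀ i j, Measure (X i j))
    [∀ i j, IsProbabilityMeasure (μ i j)] :
    (Measure.pi fun p : (i : ι) × κ i => μ p.1 p.2).map (MeasurableEquiv.piCurry X) =
      Measure.pi fun i => Measure.pi (μ i) := by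
  simpa only [Measure.infinitePi_eq_pi] using Measure.infinitePi_map_piCurry μ

theorem hasLaw_pi_ginibre {Ω κ : Type*} [MeasurableSpace Ω] {P : Measure Ω} [Fintype κ]
    {m n : κ → Type*} [∀ k, Fintype (m k)] [∀ k, Fintype (n k)]
    {Q : ∀ k, Ω → Matrix (m k) (n k) ℂ}
    (hlaw : ∀ k i j, HasLaw (fun ω => Q k ω i j) stdComplexGaussian P)
    (hindep : iIndepFun (fun (e : (k : κ) × (m k × n k)) ω => Q e.1 ω e.2.1 e.2.2) P) :
    HasLaw (fun ω k => Q k ω) (Measure.pi fun k => ginibre (m k) (n k)) P := by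
  have hentries := hindep.hasLaw_pi fun e : (k : κ) × (m k × n k) => hlaw e.1 e.2.1 e.2.2
  have hblocks : HasLaw (MeasurableEquiv.piCurry fun (k : κ) (_ : m k × n k) => ℂ)
      (Measure.pi fun k => Measure.pi fun _ : m k × n k => stdComplexGaussian)
      (Measure.pi fun _ : (k : κ) × (m k × n k) => stdComplexGaussian) :=
    ⟨(MeasurableEquiv.measurable _).aemeasurable,
      pi_sigma_map_piCurry fun (k : κ) (_ : m k × n k) => stdComplexGaussian⟩
  have hmatrices : HasLaw (fun x k => MeasurableEquiv.curry (m k) (n k) ℂ (x k))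
      (Measure.pi fun k => ginibre (m k) (n k))
      (Measure.pi fun k => Measure.pi fun _ : m k × n k => stdComplexGaussian) := by
    refine ⟨(measurable_pi_lambda _ fun k =>
      (MeasurableEquiv.measurable _).comp (measurable_pi_apply k)).aemeasurable, ?_⟩
    simp_rw [ginibre_eq_map_pi_stdComplexGaussian]
    exact Measure.pi_map_pi fun k => (MeasurableEquiv.measurable _).aemeasurable
  exact hmatrices.comp (hblocks.comp hentries)

end IndependentGinibre

section Chain

variable {K : ℕ} {N : Fin (K + 1) → ℕ}

theorem chainProd_zero (Q : ∀ k : Fin K, Matrix (Fin (N k.succ)) (Fin (N k.castSucc)) ℂ) :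
    chainProd Q 0 = 1 := rfl

theorem chainProd_succ (Q : ∀ k : Fin K, Matrix (Fin (N k.succ)) (Fin (N k.castSucc)) ℂ)
    (k : Fin K) : chainProd Q k.succ = Q k * chainProd Q k.castSucc := rfl

theorem measurable_matrix_mul {m n p : Type*} [Countable m] [Fintype n] [Countable p] :
    Measurable fun X : Matrix m n ℂ × Matrix n p ℂ => X.1 * X.2 :=
  Continuous.measurable (by fun_prop)

theorem measurable_chainProd_iSup_comap (i : Fin (K + 1)) :
    Measurable[⨆ j ∈ {j : Fin K | j.castSucc < i}, MeasurableSpace.comap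
      (fun Q : ∀ k : Fin K, Matrix (Fin (N k.succ)) (Fin (N k.castSucc)) ℂ => Q j) inferInstance]
      fun Q => chainProd Q i := by
  induction i using Fin.induction with
  | zero => exact measurable_const
  | succ k ih =>
    have hle : MeasurableSpace.comap
        (fun Q : ∀ k : Fin K, Matrix (Fin (N k.succ)) (Fin (N k.castSucc)) ℂ => Q k)
          inferInstance ≤
        ⨆ j ∈ {j : Fin K | j.castSucc < k.succ}, MeasurableSpace.comap
          (fun Q : ∀ k : Fin K, Matrix (Fin (N k.succ)) (Fin (N k.castSucc)) ℂ => Q j)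
          inferInstance :=
      le_iSup₂_of_le k k.castSucc_lt_succ le_rfl
    have hfactor := (comap_measurable _).mono hle le_rfl
    have hprefix := ih.mono
      (biSup_mono fun j (hj : j.castSucc < k.castSucc) => hj.trans k.castSucc_lt_succ) le_rfl
    exact measurable_matrix_mul.comp (hfactor.prodMk hprefix)

theorem measurable_chainProd (i : Fin (K + 1)) :
    Measurable fun Q : ∀ k : Fin K, Matrix (Fin (N k.succ)) (Fin (N k.castSucc)) ℂ =>
      chainProd Q i :=
  (measurable_chainProd_iSup_comap i).mono
    (iSup₂_le fun j _ => (measurable_pi_apply j).comap_le) le_rfl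

theorem indepFun_chainProd_castSucc_eval
    (μ : ∀ k : Fin K, Measure (Matrix (Fin (N k.succ)) (Fin (N k.castSucc)) ℂ))
    [∀ k, IsProbabilityMeasure (μ k)] (k : Fin K) :
    IndepFun (fun Q => chainProd Q k.castSucc) (fun Q => Q k) (Measure.pi μ) := by
  have hindep := iIndepFun_pi (μ := μ) (X := fun _ => id) fun _ => aemeasurable_id
  have hdisjoint : Disjoint {j : Fin K | j.castSucc < k.castSucc} {k} := by simp
  have := indep_iSup_of_disjoint (fun j => (measurable_pi_apply j).comap_le) hindep.iIndep hdisjoint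
  rw [iSup_singleton] at this
  exact indep_of_indep_of_le_left this (measurable_chainProd_iSup_comap k.castSucc).comap_le

theorem filter_castSucc_lt_succ (k : Fin K) :
    ({j | j.castSucc < k.succ} : Finset (Fin K)) =
      insert k ({j | j.castSucc < k.castSucc} : Finset (Fin K)) := by
  ext j
  simp [Fin.castSucc_lt_succ_iff, le_iff_eq_or_lt]

theorem hasLogMean_gramDet_chainProd (hN : ∀ k, N 0 ≤ N k) (i : Fin (K + 1)) :
    HasLogMean (fun Q => gramDet (chainProd Q i))
      (Measure.pi fun k : Fin K => ginibre (Fin (N k.succ)) (Fin (N k.castSucc)))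
      (∑ k : Fin K with k.castSucc < i, ∑ l ∈ Finset.Icc 1 (N 0),
        logDeriv Real.Gamma (N k.succ - l + 1)) := by
  induction i using Fin.induction with
  | zero => simpa [chainProd_zero, gramDet_one] using HasLogMean.one
  | succ k ih =>
    have hP : HasLaw (fun Q => chainProd Q k.castSucc) _
        (Measure.pi fun k : Fin K => ginibre (Fin (N k.succ)) (Fin (N k.castSucc))) :=
      ⟨(measurable_chainProd k.castSucc).aemeasurable, rfl⟩
    have hpair := (indepFun_chainProd_castSucc_eval _ k).hasLaw_prod hP
      (measurePreserving_eval _ k).hasLaw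
    have := hP.isProbabilityMeasure_iff.1 inferInstance
    have hmul : Measurable fun p : Matrix (Fin (N k.castSucc)) (Fin (N 0)) ℂ ×
        Matrix (Fin (N k.succ)) (Fin (N k.castSucc)) ℂ => gramDet (p.2 * p.1) :=
      measurable_gramDet.comp (measurable_matrix_mul.comp measurable_swap)
    have hfactor := hasLogMean_gramDet_ginibre (m := Fin (N k.succ)) (n := N 0)
      (by simpa using hN _)
    rw [Fintype.card_fin] at hfactor
    rw [filter_castSucc_lt_succ, Finset.sum_insert (by simp),
      add_comm (∑ l ∈ Finset.Icc 1 (N 0), _)]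
    simp_rw [chainProd_succ]
    refine (HasLogMean.comp_iff_of_hasLaw hpair hmul).2 ?_
    exact ((HasLogMean.comp_iff_of_hasLaw hP measurable_gramDet).1 ih).prod_of_hasLaw_div
      measurable_gramDet hmul hfactor measurable_gramDet fun A => hasLaw_gramDet_mul_div_ginibre

theorem hasLogMean_gramDet_productMatrix {Ω : Type*} [MeasurableSpace Ω] {P : Measure Ω}
    (hN : ∀ k, N 0 ≤ N k) {Q : ∀ k : Fin K, Ω → Matrix (Fin (N k.succ)) (Fin (N k.castSucc)) ℂ}
    (hlaw : ∀ k i j, HasLaw (fun ω => Q k ω i j) stdComplexGaussian P)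
    (hindep : iIndepFun (fun (e : (k : Fin K) × (Fin (N k.succ) × Fin (N k.castSucc))) ω =>
      Q e.1 ω e.2.1 e.2.2) P) :
    HasLogMean (fun ω => gramDet (productMatrix fun k => Q k ω)) P
      (∑ k : Fin K, ∑ l ∈ Finset.Icc 1 (N 0), logDeriv Real.Gamma (N k.succ - l + 1)) := by
  have hchain := hasLogMean_gramDet_chainProd hN (Fin.last K)
  simp only [Fin.castSucc_lt_last, Finset.filter_true] at hchain
  exact (HasLogMean.comp_iff_of_hasLaw (hasLaw_pi_ginibre hlaw hindep)
    (measurable_gramDet.comp (measurable_chainProd (Fin.last K)))).2 hchain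

end Chain

section Digamma

theorem logDeriv_Gamma_natCast_add_one (n : ℕ) :
    logDeriv Real.Gamma (n + 1) =
      -Real.eulerMascheroniConstant + ∑ r ∈ Finset.Icc 1 n, 1 / (r : ℝ) := by
  rw [logDeriv_apply, Real.deriv_Gamma_nat, Real.Gamma_nat_eq_factorial,
    mul_div_cancel_left₀ _ (by positivity), harmonic_eq_sum_Icc]
  simp

theorem digamma_natCast_add_one (n : ℕ) :
    Complex.digamma (n + 1) = (logDeriv Real.Gamma (n + 1) : ℝ) := by
  have hfactorial : (n.factorial : ℂ) ≠ 0 := Nat.cast_ne_zero.2 n.factorial_ne_zero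
  rw [Complex.digamma_def, logDeriv_apply, Complex.deriv_Gamma_nat, Complex.Gamma_nat_eq_factorial,
    mul_div_cancel_left₀ _ hfactorial, logDeriv_Gamma_natCast_add_one, harmonic_eq_sum_Icc]
  simp

theorem sum_logDeriv_Gamma_natCast_sub_add_one {m n : ℕ} (h : n ≤ m) :
    ∑ l ∈ Finset.Icc 1 n, logDeriv Real.Gamma (m - l + 1) =
      -(n * Real.eulerMascheroniConstant) +
        ∑ l ∈ Finset.Icc 1 n, ∑ r ∈ Finset.Icc 1 (m - l), 1 / (r : ℝ) := by
  have hterm : ∀ l ∈ Finset.Icc 1 n, logDeriv Real.Gamma (m - l + 1) =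
      -Real.eulerMascheroniConstant + ∑ r ∈ Finset.Icc 1 (m - l), 1 / (r : ℝ) := fun l hl => by
    rw [← Nat.cast_sub ((Finset.mem_Icc.1 hl).2.trans h), logDeriv_Gamma_natCast_add_one]
  rw [Finset.sum_congr rfl hterm, Finset.sum_add_distrib]
  simp

theorem sum_digamma_natCast_sub_add_one {m n : ℕ} (h : n ≤ m) :
    ∑ l ∈ Finset.Icc 1 n, Complex.digamma (m - l + 1) =
      (∑ l ∈ Finset.Icc 1 n, logDeriv Real.Gamma (m - l + 1) : ℝ) := by
  rw [Complex.ofReal_sum]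
  refine Finset.sum_congr rfl fun l hl => ?_
  have hle : l ≤ m := (Finset.mem_Icc.1 hl).2.trans h
  rw [← Nat.cast_sub hle, ← Nat.cast_sub hle, digamma_natCast_add_one]

end Digamma

theorem theorem1 {Ω : Type*} [MeasurableSpace Ω] (P : Measure Ω) [IsProbabilityMeasure P]
    (K : ℕ) (N : Fin (K + 1) → ℕ) (hN : ∀ k, N 0 ≤ N k)
    (Q : ∀ k : Fin K, Ω → Matrix (Fin (N k.succ)) (Fin (N k.castSucc)) ℂ)
    (hlaw : ∀ (k : Fin K) (i : Fin (N k.succ)) (j : Fin (N k.castSucc)),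
      HasLaw (fun ω => Q k ω i j) stdComplexGaussian P)
    (hindep : iIndepFun
      (fun (e : (k : Fin K) × (Fin (N k.succ) × Fin (N k.castSucc))) (ω : Ω) =>
        Q e.1 ω e.2.1 e.2.2) P)
    (H : Ω → Matrix (Fin (N (Fin.last K))) (Fin (N 0)) ℂ)
    (hH : ∀ ω, H ω = productMatrix (fun k => Q k ω)) :
    (∀ᵐ ω ∂P, ((H ω)ᴴ * H ω).det.im = 0 ∧ 0 < ((H ω)ᴴ * H ω).det.re) ∧
    Integrable (fun ω => Real.log ((H ω)ᴴ * H ω).det.re) P ∧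
    ((∫ ω, Real.log ((H ω)ᴴ * H ω).det.re ∂P : ℝ) : ℂ) =
      ∑ k : Fin K, ∑ l ∈ Finset.Icc 1 (N 0), Complex.digamma ((N k.succ : ℂ) - (l : ℂ) + 1) ∧
    ∫ ω, Real.log ((H ω)ᴴ * H ω).det.re ∂P =
      -((K : ℝ) * (N 0 : ℝ) * Real.eulerMascheroniConstant) +
        ∑ k : Fin K, ∑ l ∈ Finset.Icc 1 (N 0), ∑ r ∈ Finset.Icc 1 (N k.succ - l), 1 / (r : ℝ) := by
  have hdet (ω : Ω) : ((H ω)ᴴ * H ω).det = (gramDet (productMatrix fun k => Q k ω) : ℂ) := by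
    rw [hH, det_conjTranspose_mul_self_eq_gramDet]
  have hgram := hasLogMean_gramDet_productMatrix hN hlaw hindep
  simp only [hdet, Complex.ofReal_im, Complex.ofReal_re, true_and]
  refine ⟨hgram.pos, hgram.integrable, ?_, ?_⟩
  · rw [hgram.integral_eq, Complex.ofReal_sum]
    exact Finset.sum_congr rfl fun k _ => (sum_digamma_natCast_sub_add_one (hN k.succ)).symm
  · rw [hgram.integral_eq,
      Finset.sum_congr rfl fun k _ => sum_logDeriv_Gamma_natCast_sub_add_one (hN k.succ),
      Finset.sum_add_distrib]
    simp [mul_assoc]
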